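/- Let $\beta\in[0,1)$, $\rho\in(-1,0]$, $\overline\rho:=\sqrt{1-\rho^2}$, $\mathcal H_+:=(0,\infty)^2$, and on $\mathcal H_+$ consider the Riemannian metrics $$g=\frac1{\overline\rho^2}\left(\frac{dx^2}{y^2x^{2\beta}}-\frac{2\rho\,dx\,dy}{y^2x^\beta}+\frac{dy^2}{y^2}\right),\qquad u=\frac1{y^2}\left(\frac{dx^2}{x^{2\beta}}+dy^2\right),$$ and the map $$\bar\phi_0(x,y)=\left((1-\beta)^{\frac1{1-\beta}}\left(\frac{x^{1-\beta}}{\overline\rho(1-\beta)}-\frac{\rho y}{\overline\rho}\right)^{\frac1{1-\beta}},\,y\right).$$ Fix $\kappa>0$ (the usual normalizations are $\kappa=1$ and $\kappa=\tfrac12$). For an open $\Omega\subset\mathcal H_+$, a metric $m\in\{g,u\}$ with Laplace–Beltrami operator $\Delta_m$ and volume measure $\mu_m$, and $Z\in\Omega$, a smooth function $p:(0,\infty)\times\Omega\to\mathbb R$ is a fundamental solution at $Z$ with respect to $\mu_m$ if $\partial_s p=\kappa\Delta_m p$ and $\lim_{s\downarrow0}\int_\Omega p(s,z)f(z)\,\mu_m(dz)=f(Z)$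 for all $f\in C_c^\infty(\Omega)$. A function $K$ is a fundamental solution at $Z$ on $(\Omega,m)$ (expressed in terms of Lebesgue measure) if $K(s,z)=p(s,z)\sqrt{\det m(z)}$, that is $K(s,z)\,dz=p(s,z)\,\mu_m(dz)$, for such a $p$. For $z=(x,y)\in\mathcal H_+$ put $$J(z):=\frac{(1-\beta)^{\frac\beta{1-\beta}}}{\overline\rho\,x^\beta}\left(\frac{x^{1-\beta}}{\overline\rho(1-\beta)}-\frac{\rho y}{\overline\rho}\right)^{\frac\beta{1-\beta}}.$$ Then: 1. $\bar\phi_0$ maps $\mathcal H_+$ into $\mathcal H_+$, is differentiable there, and $\det(\nabla\bar\phi_0(z))=J(z)$ for all $z\in\mathcal H_+$. 2. Let $Z\in\mathcal H_+$. If $K^u_{\bar\phi_0(Z)}$ is a fundamental solution at $\bar\phi_0(Z)$ on $(\mathcal H_+,u)$, then $$K^g_Z(s,z):=J(z)\,K^u_{\bar\phi_0(Z)}(s,\bar\phi_0(z)),\qquad s>0,\ z\in\mathcal H_+,\tag{$*$}$$ is a fundamental solution at $Z$ on $(\mathcal H_+,g)$. Moreover, a function $K^g_Z$ is a fundamental solution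 at $Z$ on $(\mathcal H_+,g)$ if and only if it is of the form $(*)$ for a fundamental solution $K^u_{\bar\phi_0(Z)}$ at $\bar\phi_0(Z)$ on $(\bar\phi_0(\mathcal H_+),u)$. 3. If $\beta=\tfrac12$, then for all $(x,y)\in\mathcal H_+$ $$\bar\phi_0(x,y)=\left(\frac1{1-\rho^2}\left(x-\sqrt x\,\rho y+\frac{\rho^2y^2}4\right),y\right),\qquad \det(\nabla\bar\phi_0(x,y))=\frac1{1-\rho^2}\left(1-\frac{\rho y}{2\sqrt x}\right).$$ -/

import Mathlib

open scoped ContDiff Topology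

noncomputable section

namespace SABR

/-! Riemannian geometry on open subsets of the plane, in the standard coordinates `(x, y)`.
A metric is given by its matrix of coefficients. -/

/-- A metric on (an open subset of) the plane: `g z i j` are the coefficients at the point `z`. -/
abbrev PlaneMetric := ℝ × ℝ → Matrix (Fin 2) (Fin 2) ℝ

/-- Partial derivative with respect to the first (`i = 0`) or second (`i = 1`) coordinate. -/
def partialDeriv (i : Fin 2) (f : ℝ × ℝ → ℝ) (z : ℝ × ℝ) : ℝ :=
  fderiv ℝ f z (![((1 : ℝ), (0 : ℝ)), ((0 : ℝ), (1 : ℝ))] i)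

/-- The density `√(det g)` of the Riemannian volume with respect to Lebesgue measure. -/
def volDensity (g : PlaneMetric) (z : ℝ × ℝ) : ℝ :=
  Real.sqrt (g z).det

/-- The Laplace-Beltrami operator
`Δ_g f = (det g)^(-1/2) ∑ i, ∂_i ((det g)^(1/2) ∑ j, g^{ij} ∂_j f)`. -/
def laplaceBeltrami (g : PlaneMetric) (f : ℝ × ℝ → ℝ) (z : ℝ × ℝ) : ℝ :=
  (volDensity g z)⁻¹ *
    ∑ i, partialDeriv i
      (fun w => volDensity g w * ∑ j, (g w)⁻¹ i j * partialDeriv j f w) z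

/-- The Riemannian volume measure `μ_g` of `(Ω, g)`. -/
def riemannianMeasure (Ω : Set (ℝ × ℝ)) (g : PlaneMetric) : MeasureTheory.Measure (ℝ × ℝ) :=
  (MeasureTheory.volume.restrict Ω).withDensity (fun z => ENNReal.ofReal (volDensity g z))

/-- `p` is a fundamental solution at `Z` of the heat equation `∂_t p = κ Δ_g p` on `(Ω, g)`,
with respect to the Riemannian volume: it is smooth on `(0, ∞) × Ω`, solves the equation there,
and tends to the Dirac measure at `Z` as `t ↓ 0`, tested against smooth functions
with compact support in `Ω`. -/
structure IsFundamentalSolution (κ : ℝ) (Ω : Set (ℝ × ℝ)) (g : PlaneMetric) (Z : ℝ × ℝ)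
    (p : ℝ → ℝ × ℝ → ℝ) : Prop where
  smooth : ContDiffOn ℝ ∞ (fun q : ℝ × (ℝ × ℝ) => p q.1 q.2) (Set.Ioi (0 : ℝ) ×ˢ Ω)
  heat_eq : ∀ t : ℝ, 0 < t → ∀ z ∈ Ω,
    deriv (fun τ => p τ z) t = κ * laplaceBeltrami g (p t) z
  tendsto_dirac : ∀ f : ℝ × ℝ → ℝ, ContDiff ℝ ∞ f → HasCompactSupport f → tsupport f ⊆ Ω →
    Filter.Tendsto (fun t => ∫ z, p t z * f z ∂(riemannianMeasure Ω g)) (𝓝[>] 0) (𝓝 (f Z))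

/-- `K` is a fundamental solution at `Z` of the heat equation on `(Ω, g)` expressed in terms of
Lebesgue measure: `K(t, z) dz = p(t, z) μ_g(dz)`, where `p` is a fundamental solution with respect
to the Riemannian volume. -/
def IsLebesgueFundamentalSolution (κ : ℝ) (Ω : Set (ℝ × ℝ)) (g : PlaneMetric) (Z : ℝ × ℝ)
    (K : ℝ → ℝ × ℝ → ℝ) : Prop :=
  ∃ p : ℝ → ℝ × ℝ → ℝ, IsFundamentalSolution κ Ω g Z p ∧
    ∀ t : ℝ, 0 < t → ∀ z ∈ Ω, K t z = volDensity g z * p t z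

/-- The open first quadrant `(0, ∞)²`. -/
def quadrant : Set (ℝ × ℝ) := Set.Ioi (0 : ℝ) ×ˢ Set.Ioi (0 : ℝ)

/-- `ρ̄ = √(1 - ρ²)`. -/
def rhoBar (ρ : ℝ) : ℝ := Real.sqrt (1 - ρ ^ 2)

/-- The general SABR metric
`ρ̄⁻² (dx² / (y² x^(2β)) - 2 ρ dx dy / (y² x^β) + dy² / y²)`. -/
def metricG (β ρ : ℝ) : PlaneMetric := fun z =>
  (1 / rhoBar ρ ^ 2) •
    !![1 / (z.2 ^ 2 * z.1 ^ (2 * β)), -ρ / (z.2 ^ 2 * z.1 ^ β);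
       -ρ / (z.2 ^ 2 * z.1 ^ β), 1 / z.2 ^ 2]

/-- The uncorrelated SABR metric `y⁻² (dx² / x^(2β) + dy²)`. -/
def metricU (β : ℝ) : PlaneMetric := fun z =>
  (1 / z.2 ^ 2) • !![1 / z.1 ^ (2 * β), 0; 0, 1]

/-- The map `φ̄₀`, which removes the correlation. -/
def phiBar (β ρ : ℝ) (z : ℝ × ℝ) : ℝ × ℝ :=
  ((1 - β) ^ (1 / (1 - β)) *
      (z.1 ^ (1 - β) / (rhoBar ρ * (1 - β)) - ρ * z.2 / rhoBar ρ) ^ (1 / (1 - β)),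
    z.2)

/-- The explicit factor in the relation between the two kernels. -/
def kernelFactor (β ρ : ℝ) (z : ℝ × ℝ) : ℝ :=
  (1 - β) ^ (β / (1 - β)) / (rhoBar ρ * z.1 ^ β) *
    (z.1 ^ (1 - β) / (rhoBar ρ * (1 - β)) - ρ * z.2 / rhoBar ρ) ^ (β / (1 - β))

end SABR

end

open scoped ContDiff Topology

namespace SABR

open Set Filter MeasureTheory

/-! The map is an isometry of `(quadrant, g)` onto its image with the metric `u`. With `ξ =
x^(1-β)/(1-β)` one has `dξ = dx/x^β`, so `u` becomes `(dξ² + dy²)/y²` and `g` becomes `(dξ² - 2ρ dξ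
dy + dy²)/(ρ̄² y²)`. The shear `W = (ξ - ρy)/ρ̄` completes the square, `dW² + dy² = (dξ² - 2ρ dξ dy
+ dy²)/ρ̄²`, and `phiBar` is this shear read in the coordinates `(x, y)`. An isometry intertwines
the Laplacians and the volumes, hence carries fundamental solutions to fundamental solutions; these
two properties are all that `IsPlaneIsometry` records. Passing to Lebesgue densities brings in the
Jacobian (`lebesgueFundamentalSolution_iff`). The image is cut out of the quadrant by one
inequality, so a kernel on the whole quadrant is first restricted to it
(`IsFundamentalSolution.mono`). The analytic core is `laplaceBeltrami_comp_phiBar`. -/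

theorem isOpen_quadrant : IsOpen quadrant := isOpen_Ioi.prod isOpen_Ioi

theorem rhoBar_pos {ρ : ℝ} (h1 : -1 < ρ) (h0 : ρ ≤ 0) : 0 < rhoBar ρ :=
  Real.sqrt_pos.2 (by nlinarith)

theorem rhoBar_sq {ρ : ℝ} (h1 : -1 < ρ) (h0 : ρ ≤ 0) : rhoBar ρ ^ 2 = 1 - ρ ^ 2 :=
  Real.sq_sqrt (by nlinarith)

/-! ### Partial derivatives and the Laplace-Beltrami operator -/

theorem _root_.Filter.EventuallyEq.partialDeriv_eq {f h : ℝ × ℝ → ℝ} {z : ℝ × ℝ}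
    (hfh : f =ᶠ[𝓝 z] h) (i : Fin 2) : partialDeriv i f z = partialDeriv i h z := by
  rw [partialDeriv, hfh.fderiv_eq, partialDeriv]

theorem laplaceBeltrami_congr_of_eqOn {g : PlaneMetric} {Ω : Set (ℝ × ℝ)} (hΩ : IsOpen Ω)
    {f h : ℝ × ℝ → ℝ} (hfh : EqOn f h Ω) {z : ℝ × ℝ} (hz : z ∈ Ω) :
    laplaceBeltrami g f z = laplaceBeltrami g h z := by
  unfold laplaceBeltrami
  congr 1
  refine Finset.sum_congr rfl fun i _ => EventuallyEq.partialDeriv_eq ?_ i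
  filter_upwards [hΩ.mem_nhds hz] with w hw
  congr 1
  refine Finset.sum_congr rfl fun j _ => ?_
  rw [(hfh.eventuallyEq_of_mem (hΩ.mem_nhds hw)).partialDeriv_eq j]

theorem differentiableAt_partialDeriv {f : ℝ × ℝ → ℝ} {z : ℝ × ℝ} (hf : ContDiffAt ℝ ∞ f z)
    (i : Fin 2) : DifferentiableAt ℝ (partialDeriv i f) z :=
  ((hf.fderiv_right (m := 1) (by norm_cast)).differentiableAt (by simp)).clm_apply
    (differentiableAt_const _)

theorem partialDeriv_one_fst_mul (c : ℝ → ℝ) {F : ℝ × ℝ → ℝ} {z : ℝ × ℝ}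
    (hc : DifferentiableAt ℝ c z.1) (hF : DifferentiableAt ℝ F z) :
    partialDeriv 1 (fun w => c w.1 * F w) z = c z.1 * partialDeriv 1 F z := by
  have h := ((hc.hasDerivAt.comp_hasFDerivAt z hasFDerivAt_fst).mul hF.hasFDerivAt).fderiv
  unfold partialDeriv
  change (fderiv ℝ ((c ∘ Prod.fst) * F) z) _ = _
  rw [h]
  simp

theorem partialDeriv_add_const_mul {F G : ℝ × ℝ → ℝ} {z : ℝ × ℝ} (a : ℝ)
    (hF : DifferentiableAt ℝ F z) (hG : DifferentiableAt ℝ G z) (i : Fin 2) :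
    partialDeriv i (fun w => F w + a * G w) z = partialDeriv i F z + a * partialDeriv i G z := by
  have h := (hF.hasFDerivAt.add (hG.hasFDerivAt.const_mul a)).fderiv
  unfold partialDeriv
  change (fderiv ℝ (F + fun w => a * G w) z) _ = _
  rw [h]
  simp

/-! ### Transport of fundamental solutions along isometries -/

/-- Test functions are pulled back to test functions by a diffeomorphism between open sets. -/
theorem testFunction_pullback {φ ψ : ℝ × ℝ → ℝ × ℝ} {Q U : Set (ℝ × ℝ)} (hQ : IsOpen Q)
    (hφ : ContDiffOn ℝ ∞ φ Q) (hψ : ContinuousOn ψ U)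
    (hψm : MapsTo ψ U Q) (hinv : LeftInvOn ψ φ Q)
    {f : ℝ × ℝ → ℝ} (hf : ContDiff ℝ ∞ f) (hfc : HasCompactSupport f) (hfU : tsupport f ⊆ U) :
    ContDiff ℝ ∞ (Q.indicator (f ∘ φ)) ∧ HasCompactSupport (Q.indicator (f ∘ φ)) ∧
      tsupport (Q.indicator (f ∘ φ)) ⊆ Q := by
  -- This compact subset of `Q` contains the support, so the extension by zero vanishes near every
  -- point outside `Q` and stays smooth there.
  have hK : IsCompact (ψ '' tsupport f) := hfc.isCompact.image_of_continuousOn (hψ.mono hfU)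
  have hKQ : ψ '' tsupport f ⊆ Q := (hψm.mono_left hfU).image_subset
  have hsupp : Function.support (Q.indicator (f ∘ φ)) ⊆ ψ '' tsupport f := by
    intro z hz
    rw [support_indicator] at hz
    exact ⟨φ z, subset_tsupport f hz.2, hinv hz.1⟩
  have hts : tsupport (Q.indicator (f ∘ φ)) ⊆ ψ '' tsupport f :=
    closure_minimal hsupp hK.isClosed
  refine ⟨contDiff_iff_contDiffAt.2 fun z => ?_, HasCompactSupport.intro' hK hK.isClosed ?_,
    hts.trans hKQ⟩
  · by_cases hz : z ∈ Q
    · refine ((hf.contDiffAt (x := φ z)).comp z (hφ.contDiffAt (hQ.mem_nhds hz))).congr_of_eventuallyEq ?_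
      filter_upwards [hQ.mem_nhds hz] with w hw
      simp [hw]
    · refine (contDiffAt_const (c := (0 : ℝ))).congr_of_eventuallyEq ?_
      filter_upwards [hK.isClosed.isOpen_compl.mem_nhds fun h => hz (hKQ h)] with w hw
      by_contra h
      exact hw (hsupp h)
  · intro z hz
    by_contra h
    exact hz (hsupp h)

theorem integral_riemannianMeasure {Ω : Set (ℝ × ℝ)} {g : PlaneMetric}
    (hg : Measurable (volDensity g)) (F : ℝ × ℝ → ℝ) :
    ∫ z, F z ∂(riemannianMeasure Ω g) = ∫ z in Ω, volDensity g z * F z := by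
  rw [riemannianMeasure, integral_withDensity_eq_integral_toReal_smul
    hg.ennreal_ofReal (ae_of_all _ fun _ => ENNReal.ofReal_lt_top)]
  refine integral_congr_ae (ae_of_all _ fun z => ?_)
  simp [volDensity, ENNReal.toReal_ofReal, Real.sqrt_nonneg]

/-- Data of an isometry `φ : (Q, g) → (U, u)` between open sets, with inverse `ψ`. -/
structure IsPlaneIsometry (φ ψ : ℝ × ℝ → ℝ × ℝ) (Q U : Set (ℝ × ℝ)) (g u : PlaneMetric) :
    Prop where
  isOpen_source : IsOpen Q
  isOpen_target : IsOpen U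
  mapsTo : MapsTo φ Q U
  mapsTo_symm : MapsTo ψ U Q
  leftInv : LeftInvOn ψ φ Q
  rightInv : RightInvOn ψ φ U
  contDiffOn : ContDiffOn ℝ ∞ φ Q
  contDiffOn_symm : ContDiffOn ℝ ∞ ψ U
  measurable_source : Measurable (volDensity g)
  measurable_target : Measurable (volDensity u)
  volDensity_eq : ∀ z ∈ Q, volDensity g z = |(fderiv ℝ φ z).det| * volDensity u (φ z)
  laplaceBeltrami_comp : ∀ f : ℝ × ℝ → ℝ, ContDiffOn ℝ ∞ f U → ∀ z ∈ Q,
    laplaceBeltrami g (f ∘ φ) z = laplaceBeltrami u f (φ z)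

namespace IsPlaneIsometry

variable {φ ψ : ℝ × ℝ → ℝ × ℝ} {Q U : Set (ℝ × ℝ)} {g u : PlaneMetric}

theorem image_eq (h : IsPlaneIsometry φ ψ Q U g u) : φ '' Q = U :=
  Subset.antisymm h.mapsTo.image_subset fun w hw => ⟨ψ w, h.mapsTo_symm hw, h.rightInv hw⟩

/-- Change of variables, with the Jacobian absorbed by the ratio of volume densities. It needs no
integrability, so it applies to kernels known only to be smooth. -/
theorem integral_comp (h : IsPlaneIsometry φ ψ Q U g u) (F : ℝ × ℝ → ℝ) :
    ∫ w, F w ∂(riemannianMeasure U u) = ∫ z, F (φ z) ∂(riemannianMeasure Q g) := by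
  rw [integral_riemannianMeasure h.measurable_source,
    integral_riemannianMeasure h.measurable_target, ← h.image_eq,
    integral_image_eq_integral_abs_det_fderiv_smul volume h.isOpen_source.measurableSet
      (fun z hz => (((h.contDiffOn.contDiffAt (h.isOpen_source.mem_nhds hz)).differentiableAt
        (by simp)).hasFDerivAt).hasFDerivWithinAt) h.leftInv.injOn]
  refine setIntegral_congr_fun h.isOpen_source.measurableSet fun z hz => ?_
  simp only [smul_eq_mul]
  rw [h.volDensity_eq z hz, mul_assoc]

theorem integral_riemannianMeasure_congr {Ω : Set (ℝ × ℝ)} (hΩ : IsOpen Ω)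
    (hg : Measurable (volDensity g)) {F G : ℝ × ℝ → ℝ} (hFG : EqOn F G Ω) :
    ∫ z, F z ∂(riemannianMeasure Ω g) = ∫ z, G z ∂(riemannianMeasure Ω g) := by
  rw [integral_riemannianMeasure hg, integral_riemannianMeasure hg]
  exact setIntegral_congr_fun hΩ.measurableSet fun z hz => by simp only [hFG hz]

/-- A test function `f` on `Q` is traded for `f ∘ ψ`, extended by zero outside `U`; the change of
variables then turns one Dirac limit into the other. -/
theorem fundamentalSolution_pullback (h : IsPlaneIsometry φ ψ Q U g u) {κ : ℝ} {Z : ℝ × ℝ}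
    (hZ : Z ∈ Q) {q : ℝ → ℝ × ℝ → ℝ} (hq : IsFundamentalSolution κ U u (φ Z) q) :
    IsFundamentalSolution κ Q g Z (fun t z => q t (φ z)) where
  smooth := by
    have : ContDiffOn ℝ ∞ (fun r : ℝ × (ℝ × ℝ) => (r.1, φ r.2)) (Ioi 0 ×ˢ Q) :=
      contDiff_fst.contDiffOn.prodMk (h.contDiffOn.comp contDiff_snd.contDiffOn fun r hr => hr.2)
    exact hq.smooth.comp this fun r hr => ⟨hr.1, h.mapsTo hr.2⟩
  heat_eq t ht z hz := by
    have hs : ContDiffOn ℝ ∞ (q t) U :=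
      hq.smooth.comp (f := fun w : ℝ × ℝ => (t, w)) (contDiff_prodMk_right t).contDiffOn
        fun w hw => ⟨ht, hw⟩
    rw [hq.heat_eq t ht _ (h.mapsTo hz), ← h.laplaceBeltrami_comp _ hs z hz]
    rfl
  tendsto_dirac f hf hfc hfQ := by
    obtain ⟨h1, h2, h3⟩ := testFunction_pullback h.isOpen_target h.contDiffOn_symm
      h.contDiffOn.continuousOn h.mapsTo h.rightInv hf hfc hfQ
    have := hq.tendsto_dirac _ h1 h2 h3
    simp only [h.integral_comp] at this
    rw [indicator_of_mem (h.mapsTo hZ), Function.comp_apply, h.leftInv hZ] at this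
    refine this.congr fun t => integral_riemannianMeasure_congr h.isOpen_source
      h.measurable_source fun z hz => ?_
    simp only [indicator_of_mem (h.mapsTo hz), Function.comp_apply, h.leftInv hz]

theorem fundamentalSolution_pushforward (h : IsPlaneIsometry φ ψ Q U g u) {κ : ℝ} {Z : ℝ × ℝ}
    (hZ : Z ∈ Q) {p : ℝ → ℝ × ℝ → ℝ} (hp : IsFundamentalSolution κ Q g Z p) :
    IsFundamentalSolution κ U u (φ Z) (fun t w => p t (ψ w)) where
  smooth := by
    have : ContDiffOn ℝ ∞ (fun r : ℝ × (ℝ × ℝ) => (r.1, ψ r.2)) (Ioi 0 ×ˢ U) :=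
      contDiff_fst.contDiffOn.prodMk
        (h.contDiffOn_symm.comp contDiff_snd.contDiffOn fun r hr => hr.2)
    exact hp.smooth.comp this fun r hr => ⟨hr.1, h.mapsTo_symm hr.2⟩
  heat_eq t ht w hw := by
    have hs : ContDiffOn ℝ ∞ (fun w => p t (ψ w)) U :=
      hp.smooth.comp (f := fun w : ℝ × ℝ => (t, ψ w))
        (contDiffOn_const.prodMk h.contDiffOn_symm) fun w hw => ⟨ht, h.mapsTo_symm hw⟩
    -- Writing `w = φ (ψ w)` lets the same Laplacian identity serve the inverse direction; `p t ∘ ψ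
    -- ∘ φ` equals `p t` only on `Q`, so locality of the operator finishes.
    rw [hp.heat_eq t ht _ (h.mapsTo_symm hw), ← h.rightInv hw,
      ← h.laplaceBeltrami_comp _ hs _ (h.mapsTo_symm hw), h.rightInv hw]
    congr 1
    refine laplaceBeltrami_congr_of_eqOn h.isOpen_source (fun z hz => ?_) (h.mapsTo_symm hw)
    simp only [Function.comp_apply, h.leftInv hz]
  tendsto_dirac f hf hfc hfU := by
    obtain ⟨h1, h2, h3⟩ := testFunction_pullback h.isOpen_source h.contDiffOn
      h.contDiffOn_symm.continuousOn h.mapsTo_symm h.leftInv hf hfc hfU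
    have := hp.tendsto_dirac _ h1 h2 h3
    rw [indicator_of_mem hZ, Function.comp_apply] at this
    simp only [h.integral_comp]
    refine this.congr fun t => integral_riemannianMeasure_congr h.isOpen_source
      h.measurable_source fun z hz => ?_
    simp only [indicator_of_mem hz, Function.comp_apply, h.leftInv hz]

/-- Along an isometry, the fundamental solutions in terms of Lebesgue measure correspond to each
other through the Jacobian determinant. -/
theorem lebesgueFundamentalSolution_iff (h : IsPlaneIsometry φ ψ Q U g u) {κ : ℝ} {Z : ℝ × ℝ}
    (hZ : Z ∈ Q) (Kg : ℝ → ℝ × ℝ → ℝ) :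
    IsLebesgueFundamentalSolution κ Q g Z Kg ↔
      ∃ Ku, IsLebesgueFundamentalSolution κ U u (φ Z) Ku ∧
        ∀ s : ℝ, 0 < s → ∀ z ∈ Q, Kg s z = |(fderiv ℝ φ z).det| * Ku s (φ z) := by
  constructor
  · rintro ⟨p, hp, hK⟩
    refine ⟨fun s w => volDensity u w * p s (ψ w),
      ⟨_, h.fundamentalSolution_pushforward hZ hp, fun _ _ _ _ => rfl⟩, fun s hs z hz => ?_⟩
    simp only [h.leftInv hz]
    rw [hK s hs z hz, h.volDensity_eq z hz, mul_assoc]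
  · rintro ⟨Ku, ⟨q, hq, hKu⟩, hK⟩
    refine ⟨_, h.fundamentalSolution_pullback hZ hq, fun s hs z hz => ?_⟩
    rw [hK s hs z hz, hKu s hs _ (h.mapsTo hz), h.volDensity_eq z hz, mul_assoc]

end IsPlaneIsometry

/-- A test function supported in `U` is also one on `Ω`, and its integrand vanishes on `Ω \ U`. -/
theorem IsFundamentalSolution.mono {κ : ℝ} {Ω U : Set (ℝ × ℝ)} {g : PlaneMetric} {Z : ℝ × ℝ}
    {p : ℝ → ℝ × ℝ → ℝ} (hp : IsFundamentalSolution κ Ω g Z p) (hU : U ⊆ Ω)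
    (hΩm : MeasurableSet Ω) (hg : Measurable (volDensity g)) :
    IsFundamentalSolution κ U g Z p where
  smooth := hp.smooth.mono (prod_mono le_rfl hU)
  heat_eq t ht z hz := hp.heat_eq t ht z (hU hz)
  tendsto_dirac f hf hfc hfU := by
    refine (hp.tendsto_dirac f hf hfc (hfU.trans hU)).congr fun t => ?_
    rw [integral_riemannianMeasure hg, integral_riemannianMeasure hg]
    refine setIntegral_eq_of_subset_of_forall_sdiff_eq_zero hΩm hU fun z hz => ?_
    rw [image_eq_zero_of_notMem_tsupport fun h => hz.2 (hfU h)]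
    ring

/-! ### The isometry removing the correlation -/

section Decorrelation

variable {β ρ : ℝ}

/-- The geodesic first coordinate after removing the correlation. -/
noncomputable def decorrelated (β ρ : ℝ) (z : ℝ × ℝ) : ℝ :=
  z.1 ^ (1 - β) / (rhoBar ρ * (1 - β)) - ρ * z.2 / rhoBar ρ

/-- Since `ρ ≤ 0`, the term `-ρy/ρ̄` is nonnegative, so the real power in `phiBar` has a positive
base. -/
theorem decorrelated_pos (hβ1 : β < 1) (hρ : -1 < ρ) (hρ0 : ρ ≤ 0) {z : ℝ × ℝ}
    (hz : z ∈ quadrant) : 0 < decorrelated β ρ z := by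
  obtain ⟨hx, hy⟩ : 0 < z.1 ∧ 0 < z.2 := hz
  have hr := rhoBar_pos hρ hρ0
  have hb : 0 < 1 - β := by linarith
  have h1 : 0 < z.1 ^ (1 - β) / (rhoBar ρ * (1 - β)) := by positivity
  have h2 : ρ * z.2 / rhoBar ρ ≤ 0 :=
    div_nonpos_of_nonpos_of_nonneg (mul_nonpos_of_nonpos_of_nonneg hρ0 hy.le) hr.le
  unfold decorrelated; linarith

theorem phiBar_fst (hβ1 : β < 1) (hρ : -1 < ρ) (hρ0 : ρ ≤ 0) {z : ℝ × ℝ}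
    (hz : z ∈ quadrant) :
    (phiBar β ρ z).1 = ((1 - β) * decorrelated β ρ z) ^ (1 / (1 - β)) := by
  rw [Real.mul_rpow (by linarith) (decorrelated_pos hβ1 hρ hρ0 hz).le]
  rfl

theorem mapsTo_phiBar_quadrant (hβ1 : β < 1) (hρ : -1 < ρ) (hρ0 : ρ ≤ 0) :
    MapsTo (phiBar β ρ) quadrant quadrant := fun z hz =>
  ⟨by
    rw [mem_Ioi, phiBar_fst hβ1 hρ hρ0 hz]
    exact Real.rpow_pos_of_pos (mul_pos (by linarith) (decorrelated_pos hβ1 hρ hρ0 hz)) _, hz.2⟩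

/-- The factor is the quotient of the volume coefficients. -/
theorem kernelFactor_eq (hβ1 : β < 1) (hρ : -1 < ρ) (hρ0 : ρ ≤ 0) {z : ℝ × ℝ}
    (hz : z ∈ quadrant) :
    kernelFactor β ρ z = (phiBar β ρ z).1 ^ β / (rhoBar ρ * z.1 ^ β) := by
  have hW := decorrelated_pos hβ1 hρ hρ0 hz
  have hb : 0 < 1 - β := by linarith
  rw [phiBar_fst hβ1 hρ hρ0 hz, ← Real.rpow_mul (by positivity),
    show 1 / (1 - β) * β = β / (1 - β) by ring, Real.mul_rpow hb.le hW.le]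
  unfold kernelFactor
  rw [← decorrelated]
  ring

theorem kernelFactor_pos (hβ1 : β < 1) (hρ : -1 < ρ) (hρ0 : ρ ≤ 0) {z : ℝ × ℝ}
    (hz : z ∈ quadrant) : 0 < kernelFactor β ρ z := by
  rw [kernelFactor_eq hβ1 hρ hρ0 hz]
  have h1 : 0 < (phiBar β ρ z).1 := (mapsTo_phiBar_quadrant hβ1 hρ hρ0 hz).1
  have h2 : 0 < z.1 := hz.1
  have := rhoBar_pos hρ hρ0
  positivity

/-- With `X` the first coordinate of the image, `X^(1-β)/(1-β) = W` gives `dX = X^β dW`, where `dW =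
dx/(ρ̄ x^β) - (ρ/ρ̄) dy`. -/
theorem hasFDerivAt_phiBar (hβ1 : β < 1) (hρ : -1 < ρ) (hρ0 : ρ ≤ 0) {z : ℝ × ℝ}
    (hz : z ∈ quadrant) :
    HasFDerivAt (phiBar β ρ)
      (Matrix.toLin (Module.Basis.finTwoProd ℝ) (Module.Basis.finTwoProd ℝ)
        !![kernelFactor β ρ z, -ρ * (phiBar β ρ z).1 ^ β / rhoBar ρ; 0, 1]).toContinuousLinearMap
      z := by
  have hW := decorrelated_pos hβ1 hρ hρ0 hz
  have hb : 0 < 1 - β := by linarith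
  have hx : 0 < z.1 := hz.1
  have hr := rhoBar_pos hρ hρ0
  rw [Matrix.toLin_finTwoProd_toContinuousLinearMap]
  refine HasFDerivAt.prodMk ?_ (hasFDerivAt_snd.congr_fderiv (by ext <;> simp))
  have h1 : HasFDerivAt (decorrelated β ρ) _ z :=
    ((hasFDerivAt_fst.rpow_const (p := 1 - β) (Or.inl hx.ne')).mul_const
      (rhoBar ρ * (1 - β))⁻¹).sub ((hasFDerivAt_snd.const_mul ρ).mul_const (rhoBar ρ)⁻¹)
  have h2 := (h1.rpow_const (p := 1 / (1 - β)) (Or.inl hW.ne')).const_mul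
    ((1 - β) ^ (1 / (1 - β)))
  -- The right side is `dX/dW` as the power rule produces it.
  have hE : (phiBar β ρ z).1 ^ β = (1 - β) ^ (1 / (1 - β)) *
      (1 / (1 - β) * decorrelated β ρ z ^ (1 / (1 - β) - 1)) := by
    rw [phiBar_fst hβ1 hρ hρ0 hz, ← Real.rpow_mul (by positivity),
      show 1 / (1 - β) * β = 1 / (1 - β) - 1 by field_simp; ring, Real.mul_rpow hb.le hW.le,
      Real.rpow_sub_one hb.ne' (1 / (1 - β))]
    ring
  have hxb : z.1 ^ (1 - β - 1) = (z.1 ^ β)⁻¹ := by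
    rw [← Real.rpow_neg hx.le]; congr 1; ring
  refine h2.congr_fderiv ?_
  have hxp := Real.rpow_pos_of_pos hx β
  rw [kernelFactor_eq hβ1 hρ hρ0 hz, hE, hxb]
  ext <;> simp <;> field_simp

theorem det_fderiv_phiBar (hβ1 : β < 1) (hρ : -1 < ρ) (hρ0 : ρ ≤ 0) {z : ℝ × ℝ}
    (hz : z ∈ quadrant) : (fderiv ℝ (phiBar β ρ) z).det = kernelFactor β ρ z := by
  rw [(hasFDerivAt_phiBar hβ1 hρ hρ0 hz).fderiv]
  simp [LinearMap.det_toContinuousLinearMap, LinearMap.det_toLin, Matrix.det_fin_two]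

/-- The inverse of `phiBar`. -/
noncomputable def phiBarSymm (β ρ : ℝ) (w : ℝ × ℝ) : ℝ × ℝ :=
  ((rhoBar ρ * w.1 ^ (1 - β) + (1 - β) * ρ * w.2) ^ (1 / (1 - β)), w.2)

/-- The image of the quadrant under `phiBar`. -/
def correlatedRegion (β ρ : ℝ) : Set (ℝ × ℝ) :=
  {w | w ∈ quadrant ∧ 0 < rhoBar ρ * w.1 ^ (1 - β) + (1 - β) * ρ * w.2}

/-- Solving the shear for `x`: this yields both the inequality describing the image and the left
inverse. -/
theorem phiBar_fst_rpow (hβ1 : β < 1) (hρ : -1 < ρ) (hρ0 : ρ ≤ 0) {z : ℝ × ℝ}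
    (hz : z ∈ quadrant) :
    rhoBar ρ * (phiBar β ρ z).1 ^ (1 - β) + (1 - β) * ρ * (phiBar β ρ z).2 = z.1 ^ (1 - β) := by
  have hW := decorrelated_pos hβ1 hρ hρ0 hz
  have hb : 0 < 1 - β := by linarith
  have hr := rhoBar_pos hρ hρ0
  rw [phiBar_fst hβ1 hρ hρ0 hz, one_div, Real.rpow_inv_rpow (by positivity) hb.ne']
  simp only [decorrelated, phiBar]
  field_simp
  ring

/-! ### Volume densities and inverse matrices of the two metrics -/

theorem measurable_volDensity {g : PlaneMetric} (h : ∀ i j, Measurable fun z => g z i j) :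
    Measurable (volDensity g) := by
  unfold volDensity
  simp only [Matrix.det_fin_two]
  exact (((h 0 0).mul (h 1 1)).sub ((h 0 1).mul (h 1 0))).sqrt

theorem measurable_volDensity_metricG : Measurable (volDensity (metricG β ρ)) := by
  refine measurable_volDensity fun i j => ?_
  fin_cases i <;> fin_cases j <;> simp [metricG] <;> fun_prop

theorem measurable_volDensity_metricU : Measurable (volDensity (metricU β)) := by
  refine measurable_volDensity fun i j => ?_
  fin_cases i <;> fin_cases j <;> simp [metricU] <;> fun_prop

theorem rpow_two_mul {x : ℝ} (hx : 0 < x) (β : ℝ) : x ^ (2 * β) = (x ^ β) ^ 2 := by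
  rw [mul_comm, Real.rpow_mul hx.le, Real.rpow_two]

theorem volDensity_metricG (hρ : -1 < ρ) (hρ0 : ρ ≤ 0) {z : ℝ × ℝ} (hz : z ∈ quadrant) :
    volDensity (metricG β ρ) z = 1 / (rhoBar ρ * z.2 ^ 2 * z.1 ^ β) := by
  obtain ⟨hx, hy⟩ : 0 < z.1 ∧ 0 < z.2 := hz
  have hr := rhoBar_pos hρ hρ0
  have hxp := Real.rpow_pos_of_pos hx β
  have hs := rhoBar_sq hρ hρ0
  rw [volDensity, ← Real.sqrt_sq (show 0 ≤ 1 / (rhoBar ρ * z.2 ^ 2 * z.1 ^ β) by positivity)]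
  congr 1
  simp only [metricG, Matrix.det_fin_two, Matrix.smul_apply, Matrix.of_apply, Matrix.cons_val',
    Matrix.cons_val_zero, Matrix.cons_val_one, Matrix.cons_val_fin_one, smul_eq_mul,
    rpow_two_mul hx]
  field_simp
  linarith

theorem volDensity_metricU {z : ℝ × ℝ} (hz : z ∈ quadrant) :
    volDensity (metricU β) z = 1 / (z.2 ^ 2 * z.1 ^ β) := by
  obtain ⟨hx, hy⟩ : 0 < z.1 ∧ 0 < z.2 := hz
  have hxp := Real.rpow_pos_of_pos hx β
  rw [volDensity, ← Real.sqrt_sq (show 0 ≤ 1 / (z.2 ^ 2 * z.1 ^ β) by positivity)]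
  congr 1
  simp only [metricU, Matrix.det_fin_two, Matrix.smul_apply, Matrix.of_apply, Matrix.cons_val',
    Matrix.cons_val_zero, Matrix.cons_val_one, Matrix.cons_val_fin_one, smul_eq_mul,
    rpow_two_mul hx]
  field_simp
  ring

theorem inv_metricU {z : ℝ × ℝ} (hz : z ∈ quadrant) :
    (metricU β z)⁻¹ = !![z.2 ^ 2 * (z.1 ^ β) ^ 2, 0; 0, z.2 ^ 2] := by
  obtain ⟨hx, hy⟩ : 0 < z.1 ∧ 0 < z.2 := hz
  have hxp := Real.rpow_pos_of_pos hx β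
  refine Matrix.inv_eq_right_inv ?_
  ext i j
  fin_cases i <;> fin_cases j <;>
    simp [metricU, Matrix.mul_apply, Fin.sum_univ_two, rpow_two_mul hx] <;> field_simp

theorem inv_metricG (hρ : -1 < ρ) (hρ0 : ρ ≤ 0) {z : ℝ × ℝ} (hz : z ∈ quadrant) :
    (metricG β ρ z)⁻¹ = !![z.2 ^ 2 * (z.1 ^ β) ^ 2, z.2 ^ 2 * ρ * z.1 ^ β;
      z.2 ^ 2 * ρ * z.1 ^ β, z.2 ^ 2] := by
  obtain ⟨hx, hy⟩ : 0 < z.1 ∧ 0 < z.2 := hz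
  have hxp := Real.rpow_pos_of_pos hx β
  have hr := rhoBar_pos hρ hρ0
  have hs := rhoBar_sq hρ hρ0
  refine Matrix.inv_eq_right_inv ?_
  ext i j
  fin_cases i <;> fin_cases j <;>
    simp [metricG, Matrix.mul_apply, Fin.sum_univ_two, rpow_two_mul hx] <;> field_simp <;>
    linarith

/-! ### Invariance of the Laplace-Beltrami operator -/

theorem laplaceBeltrami_metricU {f : ℝ × ℝ → ℝ} {z : ℝ × ℝ} (hz : z ∈ quadrant)
    (hf : DifferentiableAt ℝ (partialDeriv 1 f) z) :
    laplaceBeltrami (metricU β) f z = z.2 ^ 2 *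
      (z.1 ^ β * partialDeriv 0 (fun w => w.1 ^ β * partialDeriv 0 f w) z +
        partialDeriv 1 (partialDeriv 1 f) z) := by
  have hx : 0 < z.1 := hz.1
  have hy : 0 < z.2 := hz.2
  have hxp := Real.rpow_pos_of_pos hx β
  have e0 : (fun w => volDensity (metricU β) w *
      ∑ j, (metricU β w)⁻¹ 0 j * partialDeriv j f w) =ᶠ[𝓝 z]
      fun w => w.1 ^ β * partialDeriv 0 f w := by
    filter_upwards [isOpen_quadrant.mem_nhds hz] with w hw
    have hwx : 0 < w.1 := hw.1
    have hwy : 0 < w.2 := hw.2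
    have := Real.rpow_pos_of_pos hwx β
    simp [volDensity_metricU hw, inv_metricU hw]
    field_simp
  have e1 : (fun w => volDensity (metricU β) w *
      ∑ j, (metricU β w)⁻¹ 1 j * partialDeriv j f w) =ᶠ[𝓝 z]
      fun w => w.1 ^ (-β) * partialDeriv 1 f w := by
    filter_upwards [isOpen_quadrant.mem_nhds hz] with w hw
    have hwx : 0 < w.1 := hw.1
    have hwy : 0 < w.2 := hw.2
    have := Real.rpow_pos_of_pos hwx β
    simp [volDensity_metricU hw, inv_metricU hw, Real.rpow_neg hwx.le]
    field_simp
  rw [laplaceBeltrami, Fin.sum_univ_two, e0.partialDeriv_eq, e1.partialDeriv_eq,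
    partialDeriv_one_fst_mul (fun x => x ^ (-β))
      (Real.differentiableAt_rpow_const_of_ne _ hx.ne') hf,
    volDensity_metricU hz, Real.rpow_neg hx.le]
  field_simp

theorem partialDeriv_zero_comp_phiBar (hβ1 : β < 1) (hρ : -1 < ρ) (hρ0 : ρ ≤ 0) {z : ℝ × ℝ}
    (hz : z ∈ quadrant) {F : ℝ × ℝ → ℝ} (hF : DifferentiableAt ℝ F (phiBar β ρ z)) :
    partialDeriv 0 (F ∘ phiBar β ρ) z =
      kernelFactor β ρ z * partialDeriv 0 F (phiBar β ρ z) := by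
  unfold partialDeriv
  rw [(hF.hasFDerivAt.comp z (hasFDerivAt_phiBar hβ1 hρ hρ0 hz)).fderiv,
    Matrix.toLin_finTwoProd_toContinuousLinearMap]
  refine (congrArg (fderiv ℝ F (phiBar β ρ z)) ?_).trans
    ((fderiv ℝ F (phiBar β ρ z)).map_smul (kernelFactor β ρ z) _)
  simp

theorem partialDeriv_one_comp_phiBar (hβ1 : β < 1) (hρ : -1 < ρ) (hρ0 : ρ ≤ 0) {z : ℝ × ℝ}
    (hz : z ∈ quadrant) {F : ℝ × ℝ → ℝ} (hF : DifferentiableAt ℝ F (phiBar β ρ z)) :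
    partialDeriv 1 (F ∘ phiBar β ρ) z =
      -ρ * (phiBar β ρ z).1 ^ β / rhoBar ρ * partialDeriv 0 F (phiBar β ρ z) +
        partialDeriv 1 F (phiBar β ρ z) := by
  unfold partialDeriv
  rw [(hF.hasFDerivAt.comp z (hasFDerivAt_phiBar hβ1 hρ hρ0 hz)).fderiv,
    Matrix.toLin_finTwoProd_toContinuousLinearMap]
  refine (congrArg (fderiv ℝ F (phiBar β ρ z)) ?_).trans
    (((fderiv ℝ F (phiBar β ρ z)).map_add (_ • _) _).trans
      (congrArg (· + _) ((fderiv ℝ F (phiBar β ρ z)).map_smul _ _)))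
  simp

/-- The two components of the `g`-flux of `f ∘ φ` simplify to `(X^β ∂₀f + (ρ/ρ̄) ∂₁f) ∘ φ` and `ρ̄⁻¹
x^(-β) (∂₁f) ∘ φ`. After one more derivative, each contributes `∂₀∂₁f` with opposite coefficients,
so the mixed terms cancel without using symmetry of second derivatives. -/
theorem laplaceBeltrami_comp_phiBar (hβ1 : β < 1) (hρ : -1 < ρ) (hρ0 : ρ ≤ 0) {z : ℝ × ℝ}
    (hz : z ∈ quadrant) {f : ℝ × ℝ → ℝ} {U : Set (ℝ × ℝ)} (hU : IsOpen U)
    (hzU : phiBar β ρ z ∈ U) (hf : ContDiffOn ℝ ∞ f U) :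
    laplaceBeltrami (metricG β ρ) (f ∘ phiBar β ρ) z =
      laplaceBeltrami (metricU β) f (phiBar β ρ z) := by
  have hx : 0 < z.1 := hz.1
  have hy : 0 < z.2 := hz.2
  have hxp := Real.rpow_pos_of_pos hx β
  have hr := rhoBar_pos hρ hρ0
  have hs := rhoBar_sq hρ hρ0
  have hφz := mapsTo_phiBar_quadrant hβ1 hρ hρ0 hz
  have hX : 0 < (phiBar β ρ z).1 := hφz.1
  have hφ := (hasFDerivAt_phiBar hβ1 hρ hρ0 hz).differentiableAt
  have hfz := hf.contDiffAt (hU.mem_nhds hzU)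
  have hnear : ∀ᶠ w in 𝓝 z, w ∈ quadrant ∧ phiBar β ρ w ∈ U :=
    (isOpen_quadrant.eventually_mem hz).and
      (hφ.continuousAt.eventually_mem (hU.mem_nhds hzU))
  set A : ℝ × ℝ → ℝ := fun w => w.1 ^ β * partialDeriv 0 f w with hA
  have hAd : DifferentiableAt ℝ A (phiBar β ρ z) :=
    (differentiableAt_fst.rpow_const (Or.inl hX.ne')).mul (differentiableAt_partialDeriv hfz 0)
  have hBd := differentiableAt_partialDeriv hfz 1
  have e0 : (fun w => volDensity (metricG β ρ) w *
      ∑ j, (metricG β ρ w)⁻¹ 0 j * partialDeriv j (f ∘ phiBar β ρ) w) =ᶠ[𝓝 z]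
      (fun w => A w + ρ / rhoBar ρ * partialDeriv 1 f w) ∘ phiBar β ρ := by
    filter_upwards [hnear] with w hw
    have hwx : 0 < w.1 := hw.1.1
    have hwy : 0 < w.2 := hw.1.2
    have := Real.rpow_pos_of_pos hwx β
    have hfw := (hf.contDiffAt (hU.mem_nhds hw.2)).differentiableAt (by simp)
    simp [volDensity_metricG hρ hρ0 hw.1, inv_metricG hρ hρ0 hw.1, hA,
      partialDeriv_zero_comp_phiBar hβ1 hρ hρ0 hw.1 hfw,
      partialDeriv_one_comp_phiBar hβ1 hρ hρ0 hw.1 hfw, kernelFactor_eq hβ1 hρ hρ0 hw.1]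
    field_simp
    linear_combination (-(phiBar β ρ w).1 ^ β * partialDeriv 0 f (phiBar β ρ w)) * hs
  have e1 : (fun w => volDensity (metricG β ρ) w *
      ∑ j, (metricG β ρ w)⁻¹ 1 j * partialDeriv j (f ∘ phiBar β ρ) w) =ᶠ[𝓝 z]
      fun w => (rhoBar ρ)⁻¹ * w.1 ^ (-β) * (partialDeriv 1 f ∘ phiBar β ρ) w := by
    filter_upwards [hnear] with w hw
    have hwx : 0 < w.1 := hw.1.1
    have hwy : 0 < w.2 := hw.1.2
    have := Real.rpow_pos_of_pos hwx β
    have hfw := (hf.contDiffAt (hU.mem_nhds hw.2)).differentiableAt (by simp)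
    simp [volDensity_metricG hρ hρ0 hw.1, inv_metricG hρ hρ0 hw.1, Real.rpow_neg hwx.le,
      partialDeriv_zero_comp_phiBar hβ1 hρ hρ0 hw.1 hfw,
      partialDeriv_one_comp_phiBar hβ1 hρ hρ0 hw.1 hfw, kernelFactor_eq hβ1 hρ hρ0 hw.1]
    field_simp
    ring
  rw [laplaceBeltrami, Fin.sum_univ_two, e0.partialDeriv_eq, e1.partialDeriv_eq,
    partialDeriv_one_fst_mul (fun x => (rhoBar ρ)⁻¹ * x ^ (-β))
      ((Real.differentiableAt_rpow_const_of_ne _ hx.ne').const_mul _) (hBd.comp z hφ),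
    partialDeriv_zero_comp_phiBar hβ1 hρ hρ0 hz
      (F := fun w => A w + ρ / rhoBar ρ * partialDeriv 1 f w) (hAd.add (hBd.const_mul _)),
    partialDeriv_one_comp_phiBar hβ1 hρ hρ0 hz hBd, partialDeriv_add_const_mul _ hAd hBd,
    laplaceBeltrami_metricU hφz hBd, ← hA, volDensity_metricG hρ hρ0 hz, Real.rpow_neg hx.le,
    kernelFactor_eq hβ1 hρ hρ0 hz, show (phiBar β ρ z).2 = z.2 from rfl]
  field_simp
  ring

/-! ### The image of the quadrant and the inverse map -/

theorem isOpen_correlatedRegion (hβ1 : β < 1) : IsOpen (correlatedRegion β ρ) := by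
  have hc : Continuous fun w : ℝ × ℝ => rhoBar ρ * w.1 ^ (1 - β) + (1 - β) * ρ * w.2 :=
    (continuous_const.mul (continuous_fst.rpow_const fun _ => Or.inr (by linarith))).add
      (continuous_const.mul continuous_snd)
  exact isOpen_quadrant.inter (isOpen_lt continuous_const hc)

theorem phiBar_phiBarSymm (hβ1 : β < 1) (hρ : -1 < ρ) (hρ0 : ρ ≤ 0) {w : ℝ × ℝ}
    (hw : w ∈ correlatedRegion β ρ) : phiBar β ρ (phiBarSymm β ρ w) = w := by
  have hb : 0 < 1 - β := by linarith
  have hr := rhoBar_pos hρ hρ0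
  have hX : 0 < w.1 := hw.1.1
  have hq : phiBarSymm β ρ w ∈ quadrant := ⟨Real.rpow_pos_of_pos hw.2 _, hw.1.2⟩
  refine Prod.ext ?_ rfl
  rw [phiBar_fst hβ1 hρ hρ0 hq, decorrelated]
  simp only [phiBarSymm, one_div]
  rw [Real.rpow_inv_rpow hw.2.le hb.ne', Real.rpow_inv_eq _ hX.le hb.ne']
  · field_simp
    ring
  · have := decorrelated_pos hβ1 hρ hρ0 hq
    simp only [decorrelated, phiBarSymm, one_div, Real.rpow_inv_rpow hw.2.le hb.ne'] at this
    positivity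

theorem isPlaneIsometry_phiBar (hβ1 : β < 1) (hρ : -1 < ρ) (hρ0 : ρ ≤ 0) :
    IsPlaneIsometry (phiBar β ρ) (phiBarSymm β ρ) quadrant (correlatedRegion β ρ)
      (metricG β ρ) (metricU β) := by
  have hm : MapsTo (phiBar β ρ) quadrant (correlatedRegion β ρ) := fun z hz =>
    ⟨mapsTo_phiBar_quadrant hβ1 hρ hρ0 hz, by
      rw [phiBar_fst_rpow hβ1 hρ hρ0 hz]; exact Real.rpow_pos_of_pos hz.1 _⟩
  refine
  { isOpen_source := isOpen_quadrant
    isOpen_target := isOpen_correlatedRegion hβ1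
    mapsTo := hm
    mapsTo_symm := fun w hw => ⟨Real.rpow_pos_of_pos hw.2 _, hw.1.2⟩
    leftInv := fun z hz => Prod.ext ?_ rfl
    rightInv := fun w hw => phiBar_phiBarSymm hβ1 hρ hρ0 hw
    contDiffOn := fun z hz => ContDiffAt.contDiffWithinAt ?_
    contDiffOn_symm := fun w hw => ContDiffAt.contDiffWithinAt ?_
    measurable_source := measurable_volDensity_metricG
    measurable_target := measurable_volDensity_metricU
    volDensity_eq := fun z hz => ?_
    laplaceBeltrami_comp := fun f hf z hz =>
      laplaceBeltrami_comp_phiBar hβ1 hρ hρ0 hz (isOpen_correlatedRegion hβ1) (hm hz) hf }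
  · change (_ : ℝ) ^ _ = _
    rw [phiBar_fst_rpow hβ1 hρ hρ0 hz, one_div, Real.rpow_rpow_inv (le_of_lt hz.1) (by linarith)]
  · have hx : 0 < z.1 := hz.1
    have h1 : ContDiffAt ℝ ∞ (decorrelated β ρ) z :=
      ((contDiffAt_fst.rpow_const_of_ne hx.ne').div_const _).sub
        ((contDiffAt_const.mul contDiffAt_snd).div_const _)
    exact (contDiffAt_const.mul (h1.rpow_const_of_ne
      (decorrelated_pos hβ1 hρ hρ0 hz).ne')).prodMk contDiffAt_snd
  · have hx : 0 < w.1 := hw.1.1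
    exact (((contDiffAt_const.mul (contDiffAt_fst.rpow_const_of_ne hx.ne')).add
      (contDiffAt_const.mul contDiffAt_snd)).rpow_const_of_ne hw.2.ne').prodMk contDiffAt_snd
  · have hφz := mapsTo_phiBar_quadrant hβ1 hρ hρ0 hz
    have hx := Real.rpow_pos_of_pos hz.1 β
    have hX := Real.rpow_pos_of_pos hφz.1 β
    have hr := rhoBar_pos hρ hρ0
    have hy : 0 < z.2 := hz.2
    rw [det_fderiv_phiBar hβ1 hρ hρ0 hz, abs_of_pos (kernelFactor_pos hβ1 hρ hρ0 hz),
      kernelFactor_eq hβ1 hρ hρ0 hz, volDensity_metricG hρ hρ0 hz, volDensity_metricU hφz,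
      show (phiBar β ρ z).2 = z.2 from rfl]
    field_simp

/-! ### The case `β = 1/2` -/

theorem phiBar_half (hρ : -1 < ρ) (hρ0 : ρ ≤ 0) {x y : ℝ} (hx : 0 < x) :
    phiBar (1 / 2) ρ (x, y) =
      (1 / (1 - ρ ^ 2) * (x - Real.sqrt x * ρ * y + ρ ^ 2 * y ^ 2 / 4), y) := by
  have hr := rhoBar_pos hρ hρ0
  have h2 : (1 : ℝ) / (1 - 1 / 2) = 2 := by norm_num
  have h3 : (1 : ℝ) - 1 / 2 = 1 / 2 := by norm_num
  refine Prod.ext ?_ rfl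
  simp only [phiBar]
  rw [h2, h3, ← Real.sqrt_eq_rpow, Real.rpow_two, Real.rpow_two, ← rhoBar_sq hρ hρ0]
  -- Only the `x` outside a root is replaced, which leaves an identity rational in `√x`.
  nth_rewrite 2 [← Real.sq_sqrt hx.le]
  field_simp
  ring

theorem kernelFactor_half (hρ : -1 < ρ) (hρ0 : ρ ≤ 0) {x y : ℝ} (hx : 0 < x) :
    kernelFactor (1 / 2) ρ (x, y) = (1 - ρ * y / (2 * Real.sqrt x)) / (1 - ρ ^ 2) := by
  have hr := rhoBar_pos hρ hρ0
  have hs := Real.sqrt_pos.2 hx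
  have h2 : (1 / 2 : ℝ) / (1 - 1 / 2) = 1 := by norm_num
  have h3 : (1 : ℝ) - 1 / 2 = 1 / 2 := by norm_num
  simp only [kernelFactor]
  rw [h2, h3, ← Real.sqrt_eq_rpow, Real.rpow_one, Real.rpow_one, ← rhoBar_sq hρ hρ0]
  field_simp

end Decorrelation

end SABR

open SABR in
theorem lemma2p6 (β ρ κ : ℝ) (hβ0 : 0 ≤ β) (hβ1 : β < 1) (hρ : -1 < ρ) (hρ0 : ρ ≤ 0)
    (hκ : 0 < κ) :
    Set.MapsTo (SABR.phiBar β ρ) SABR.quadrant SABR.quadrant ∧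
    -- the factor is the Jacobian determinant of the map
    (∀ z ∈ SABR.quadrant, DifferentiableAt ℝ (SABR.phiBar β ρ) z ∧
      (fderiv ℝ (SABR.phiBar β ρ) z).det = SABR.kernelFactor β ρ z) ∧
    -- every fundamental solution for `u` yields one for `g`
    (∀ Z ∈ SABR.quadrant, ∀ Ku : ℝ → ℝ × ℝ → ℝ,
      SABR.IsLebesgueFundamentalSolution κ SABR.quadrant (SABR.metricU β)
        (SABR.phiBar β ρ Z) Ku →
      SABR.IsLebesgueFundamentalSolution κ SABR.quadrant (SABR.metricG β ρ) Z
        (fun s z => SABR.kernelFactor β ρ z * Ku s (SABR.phiBar β ρ z))) ∧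
    -- the fundamental solutions for `g` are exactly those obtained from the image of the map
    (∀ Z ∈ SABR.quadrant, ∀ Kg : ℝ → ℝ × ℝ → ℝ,
      SABR.IsLebesgueFundamentalSolution κ SABR.quadrant (SABR.metricG β ρ) Z Kg ↔
      ∃ Ku : ℝ → ℝ × ℝ → ℝ,
        SABR.IsLebesgueFundamentalSolution κ (SABR.phiBar β ρ '' SABR.quadrant)
          (SABR.metricU β) (SABR.phiBar β ρ Z) Ku ∧
        ∀ s : ℝ, 0 < s → ∀ z ∈ SABR.quadrant,
          Kg s z = SABR.kernelFactor β ρ z * Ku s (SABR.phiBar β ρ z)) ∧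
    -- the simplified forms
    (β = 1 / 2 → ∀ x y : ℝ, 0 < x → 0 < y →
      SABR.phiBar β ρ (x, y) =
        (1 / (1 - ρ ^ 2) * (x - Real.sqrt x * ρ * y + ρ ^ 2 * y ^ 2 / 4), y) ∧
      (fderiv ℝ (SABR.phiBar β ρ) (x, y)).det =
        (1 - ρ * y / (2 * Real.sqrt x)) / (1 - ρ ^ 2)) := by 
  have hiso := isPlaneIsometry_phiBar hβ1 hρ hρ0
  have hdet : ∀ z ∈ quadrant, |(fderiv ℝ (phiBar β ρ) z).det| = kernelFactor β ρ z :=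
    fun z hz => by
      rw [det_fderiv_phiBar hβ1 hρ hρ0 hz, abs_of_pos (kernelFactor_pos hβ1 hρ hρ0 hz)]
  refine ⟨mapsTo_phiBar_quadrant hβ1 hρ hρ0, fun z hz =>
    ⟨(hasFDerivAt_phiBar hβ1 hρ hρ0 hz).differentiableAt, det_fderiv_phiBar hβ1 hρ hρ0 hz⟩,
    fun Z hZ Ku hKu => ?_, fun Z hZ Kg => ?_, ?_⟩
  · obtain ⟨p, hp, hK⟩ := hKu
    -- The kernel lives on the whole quadrant; it is restricted to the image before being pulled
    -- back.
    have hsub : correlatedRegion β ρ ⊆ quadrant := fun w hw => hw.1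
    refine (hiso.lebesgueFundamentalSolution_iff hZ _).2 ⟨Ku, ⟨p, hp.mono hsub
      isOpen_quadrant.measurableSet measurable_volDensity_metricU,
      fun t ht z hz => hK t ht z (hsub hz)⟩, fun s _ z hz => ?_⟩
    rw [hdet z hz]
  · rw [hiso.lebesgueFundamentalSolution_iff hZ, hiso.image_eq]
    refine exists_congr fun Ku => and_congr_right fun _ => forall₂_congr fun s _ =>
      forall₂_congr fun z hz => ?_
    rw [hdet z hz]
  · rintro rfl x y hx hy
    exact ⟨phiBar_half hρ hρ0 hx, by
      rw [det_fderiv_phiBar hβ1 hρ hρ0 (show (x, y) ∈ quadrant from ⟨hx, hy⟩), kernelFactor_half hρ hρ0 hx]⟩
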